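/- A Borel measure $\mu$ on $\mathbb{R}^n$ is called log-concave if $\mu(tA+(1-t)B)\ge \mu(A)^t\mu(B)^{1-t}$ for all Borel sets $A,B\subseteq\mathbb{R}^n$ and all $t\in[0,1]$, where the right-hand side is read as $0$ if $\mu(A)\mu(B)=0$. Let $V:\mathbb{R}^n\to\mathbb{R}\cup\{+\infty\}$ be Lebesgue measurable and such that $d\mu=e^{-V(x)}\,dx$ is a log-concave probability measure on $\mathbb{R}^n$. Then $V\in L^2(\mu)$ and $$\mathrm{Var}_\mu(V)=\int_{\mathbb{R}^n} V(x)^2e^{-V(x)}\,dx-\Big(\int_{\mathbb{R}^n} V(x)e^{-V(x)}\,dx\Big)^2\le n,$$ where the integrands are read as $0$ at points where $V=+\infty$. The bound is sharp for every $n$: the product exponential distribution, with density $2^{-n}e^{-\sum_{i=1}^n|x_i|}$ and hence $V(x)=\sum_{i=1}^n|x_i|+n\ln 2$, is a log-concave probability measure on $\mathbb{R}^n$ with $\mathrm{Var}_\mu(V)=n$. -/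

import Mathlib

open MeasureTheory ProbabilityTheory
open scoped Pointwise ENNReal

/-- A Borel measure `μ` is log-concave if `μ (tA + (1-t)B) ≥ μ(A)^t μ(B)^(1-t)` for all Borel sets
`A`, `B` and all `t ∈ [0,1]`, where the right-hand side is `0` as soon as `μ(A) μ(B) = 0`. With this
convention the endpoints `t = 0` and `t = 1` are trivial, so only `0 < t < 1` is written.
(`tA + (1-t)B` need not be Borel; the value of `μ` on it is that of the outer measure, which is the
value of the completed measure.) -/
def IsLogConcaveMeasure {E : Type*} [AddCommGroup E] [Module ℝ E] [MeasurableSpace E]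
    (μ : Measure E) : Prop :=
  ∀ A B : Set E, MeasurableSet A → MeasurableSet B → ∀ t : ℝ, 0 < t → t < 1 →
    μ A ^ t * μ B ^ (1 - t) ≤ μ (t • A + (1 - t) • B)

/-- The measure `e^{-V} dx` on `ℝⁿ`, for a potential `V` with values in `ℝ ∪ {+∞}`
(`e^{-∞} = 0`). -/
noncomputable def expNegMeasure {n : ℕ} (V : EuclideanSpace ℝ (Fin n) → EReal) :
    Measure (EuclideanSpace ℝ (Fin n)) :=
  volume.withDensity (fun x => EReal.exp (-V x))

/-- The product (two-sided) exponential distribution, with density `e^{-∑ |x_i|} / 2^n` on `ℝⁿ`. -/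
noncomputable def productExponential (n : ℕ) : Measure (EuclideanSpace ℝ (Fin n)) :=
  volume.withDensity (fun x => ENNReal.ofReal (Real.exp (-∑ i, |x i|) / 2 ^ n))

/-- The potential of the product exponential distribution: minus the logarithm of its density. -/
noncomputable def productExponentialPotential (n : ℕ) (x : EuclideanSpace ℝ (Fin n)) : EReal :=
  ((∑ i, |x i| + n * Real.log 2 : ℝ) : EReal)

/-! Let φ be a log-concave density and F(t) = ∫ φ ^ t. Substitution gives tⁿ F(t) = ∫ φ(x / t) ^ t
dx, whose integrand is jointly log-concave in (t, x), so tⁿ F(t) is log-concave in t by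
Prékopa–Leindler. Comparing t = 1 ± u with t = 1 gives (1 - u²)ⁿ F(1 - u) F(1 + u) ≤ F(1)² = 1
(`lintegral_rpow_mul_lintegral_rpow_le`).

For φ = e^{-V} a.e., F(1 - u) = ∫ e^{uV} dμ is the moment generating function of V. The inequality
therefore makes these moments finite for |u| < 1, which gives V ∈ L². Its logarithm, L(u) + L(-u) +
n log(1 - u²) ≤ 0 with L the cumulant generating function, is an equality at u = 0. The second
derivative there, 2 Var V - 2n, is thus nonpositive (`variance_le_of_mgf_mul_mgf_neg_le`).

The hypothesis concerns the measure, not its density. A pointwise log-concave version of the density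
is recovered from averages over small balls (`IsLogConcaveMeasure.exists_logConcave_density`).
Prékopa–Leindler itself follows from Brunn–Minkowski on the line by induction on the dimension. It
also shows that the product exponential measure is log-concave; there L is explicit and L''(0) = n.
-/

/-- The Prékopa–Leindler inequality with weight `t` for the measure `μ`. -/
def PrekopaLeindler {E : Type*} [AddCommGroup E] [Module ℝ E] [MeasurableSpace E]
    (t : ℝ) (μ : Measure E) : Prop :=
  ∀ f g h : E → ℝ≥0∞, Measurable f → Measurable g → Measurable h →
    (∀ x y, f x ^ t * g y ^ (1 - t) ≤ h (t • x + (1 - t) • y)) →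
    (∫⁻ x, f x ∂μ) ^ t * (∫⁻ x, g x ∂μ) ^ (1 - t) ≤ ∫⁻ x, h x ∂μ

/-! ### Brunn–Minkowski on the line -/

theorem IsCompact.volume_add_volume_le_volume_add {A B : Set ℝ} (hA : IsCompact A)
    (hB : IsCompact B) (hA0 : A.Nonempty) (hB0 : B.Nonempty) :
    volume A + volume B ≤ volume (A + B) := by
  -- With a = max A and b = min B, the translates A + b and a + B lie in A + B and meet only at a +
  -- b.
  obtain ⟨a, ha, hamax⟩ := hA.exists_isGreatest hA0
  obtain ⟨b, hb, hbmin⟩ := hB.exists_isLeast hB0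
  have h1 : volume ((fun x => x + b) '' A) = volume A := by
    rw [Set.image_add_right, measure_preimage_add_right]
  have h2 : volume ((fun x => a + x) '' B) = volume B := by
    rw [Set.image_add_left, measure_preimage_add]
  have hdisj : AEDisjoint volume ((fun x => x + b) '' A) ((fun x => a + x) '' B) := by
    refine measure_mono_null (t := {a + b}) ?_ (measure_singleton _)
    rintro _ ⟨⟨x, hx, rfl⟩, ⟨y, hy, hxy⟩⟩
    have := hamax hx
    have := hbmin hy
    simp only [Set.mem_singleton_iff] at *
    linarith
  have hmeas : NullMeasurableSet ((fun x => a + x) '' B) volume :=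
    (hB.image (by fun_prop)).measurableSet.nullMeasurableSet
  rw [← h1, ← h2, ← measure_union₀ hmeas hdisj]
  apply measure_mono
  rintro _ (⟨x, hx, rfl⟩ | ⟨y, hy, rfl⟩)
  · exact Set.add_mem_add hx hb
  · exact Set.add_mem_add ha hy

theorem MeasurableSet.volume_add_volume_le_volume_add {A B : Set ℝ} (hA : MeasurableSet A)
    (hB : MeasurableSet B) (hA0 : A.Nonempty) (hB0 : B.Nonempty) :
    volume A + volume B ≤ volume (A + B) := by
  obtain ⟨a, ha⟩ := hA0
  obtain ⟨b, hb⟩ := hB0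
  -- Adjoining `a` and `b` keeps the inner compact sets nonempty, as the compact case requires.
  have key : ∀ K ⊆ A, IsCompact K → ∀ L ⊆ B, IsCompact L →
      volume K + volume L ≤ volume (A + B) := fun K hK hKc L hL hLc =>
    calc volume K + volume L ≤ volume (insert a K) + volume (insert b L) := by
          gcongr <;> exact Set.subset_insert _ _
      _ ≤ volume (insert a K + insert b L) :=
          (hKc.insert a).volume_add_volume_le_volume_add (hLc.insert b)
            (Set.insert_nonempty _ _) (Set.insert_nonempty _ _)
      _ ≤ volume (A + B) := by
          gcongr
          · exact Set.insert_subset ha hK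
          · exact Set.insert_subset hb hL
  have hA' : volume A = ⨆ K : {K : Set ℝ // K ⊆ A ∧ IsCompact K}, volume K.1 := by
    rw [hA.measure_eq_iSup_isCompact, iSup_subtype]
    simp only [iSup_and]
  have hB' : volume B = ⨆ K : {K : Set ℝ // K ⊆ B ∧ IsCompact K}, volume K.1 := by
    rw [hB.measure_eq_iSup_isCompact, iSup_subtype]
    simp only [iSup_and]
  have : Nonempty {K : Set ℝ // K ⊆ A ∧ IsCompact K} := ⟨⟨∅, by simp⟩⟩
  have : Nonempty {K : Set ℝ // K ⊆ B ∧ IsCompact K} := ⟨⟨∅, by simp⟩⟩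
  rw [hA', hB']
  exact ENNReal.iSup_add_iSup_le fun K L => key _ K.2.1 K.2.2 _ L.2.1 L.2.2

theorem volume_weighted_add_le {A B : Set ℝ} (hA : MeasurableSet A) (hB : MeasurableSet B)
    (hA0 : A.Nonempty) (hB0 : B.Nonempty) {t : ℝ} (h0 : 0 < t) (h1 : t < 1) :
    ENNReal.ofReal t * volume A + ENNReal.ofReal (1 - t) * volume B ≤
      volume (t • A + (1 - t) • B) := by
  have h := (hA.const_smul_of_ne_zero h0.ne').volume_add_volume_le_volume_add
    (hB.const_smul_of_ne_zero (sub_pos.2 h1).ne') hA0.smul_set hB0.smul_set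
  simpa [Measure.addHaar_smul, abs_of_pos h0, abs_of_pos (sub_pos.2 h1)] using h

/-! ### Prékopa–Leindler on the line -/

theorem ENNReal.rpow_mul_rpow_le_weighted_add (a b : ℝ≥0∞) {t : ℝ} (h0 : 0 < t) (h1 : t < 1) :
    a ^ t * b ^ (1 - t) ≤ ENNReal.ofReal t * a + ENNReal.ofReal (1 - t) * b := by
  have h1' := sub_pos.2 h1
  have hpq : (t⁻¹).HolderConjugate (1 - t)⁻¹ := by
    rw [Real.holderConjugate_iff]
    exact ⟨(one_lt_inv₀ h0).2 h1, by simp⟩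
  have h := ENNReal.young_inequality (a ^ t) (b ^ (1 - t)) hpq
  rwa [← ENNReal.rpow_mul, ← ENNReal.rpow_mul, mul_inv_cancel₀ h0.ne', mul_inv_cancel₀ h1'.ne',
    ENNReal.rpow_one, ENNReal.rpow_one, ENNReal.ofReal_inv_of_pos h0,
    ENNReal.ofReal_inv_of_pos h1', div_eq_mul_inv, div_eq_mul_inv, inv_inv, inv_inv,
    mul_comm a, mul_comm b] at h

/-- Levels s ≥ 1 contribute nothing to the layer-cake formula. On the remaining levels the
superlevel sets of a function with supremum one are nonempty, as Brunn–Minkowski requires. -/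
theorem lintegral_eq_lintegral_meas_lt_of_le_one {f : ℝ → ℝ} (hf : Measurable f)
    (hf0 : ∀ x, 0 ≤ f x) (hf1 : ∀ x, f x ≤ 1) :
    ∫⁻ x, ENNReal.ofReal (f x) = ∫⁻ s in Set.Ioo (0 : ℝ) 1, volume {x | s < f x} := by
  rw [lintegral_eq_lintegral_meas_lt volume (ae_of_all _ hf0) hf.aemeasurable,
    ← Set.Ioo_union_Ici_eq_Ioi zero_lt_one, lintegral_union measurableSet_Ici]
  · conv_rhs => rw [← add_zero (∫⁻ s in Set.Ioo (0 : ℝ) 1, volume {x | s < f x})]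
    congr 1
    refine setLIntegral_eq_zero measurableSet_Ici fun s hs => ?_
    have : {x | s < f x} = ∅ := by
      ext x
      simpa using (hf1 x).trans hs
    simp [this]
  · rw [Set.disjoint_left]
    intro x hx hx'
    exact absurd hx.2 (not_lt.2 hx')

/-- The additive form of the one-dimensional Prékopa–Leindler inequality, for functions with
supremum one. -/
theorem weighted_add_lintegral_le_of_sup_eq_one {t : ℝ} (h0 : 0 < t) (h1 : t < 1) {f g : ℝ → ℝ}
    {h : ℝ → ℝ≥0∞} (hf : Measurable f) (hg : Measurable g) (hh : Measurable h)
    (hf0 : ∀ x, 0 ≤ f x) (hf1 : ∀ x, f x ≤ 1) (hfs : ∀ s < 1, ∃ x, s < f x)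
    (hg0 : ∀ x, 0 ≤ g x) (hg1 : ∀ x, g x ≤ 1) (hgs : ∀ s < 1, ∃ x, s < g x)
    (hfgh : ∀ x y, ENNReal.ofReal (f x) ^ t * ENNReal.ofReal (g y) ^ (1 - t) ≤
      h (t • x + (1 - t) • y)) :
    ENNReal.ofReal t * (∫⁻ x, ENNReal.ofReal (f x)) +
      ENNReal.ofReal (1 - t) * (∫⁻ x, ENNReal.ofReal (g x)) ≤ ∫⁻ x, h x := by
  have h1' := sub_pos.2 h1
  -- Truncating `h` at 1 lets the same layer-cake formula apply to it.
  have hle : ∀ x, min (h x) 1 ≤ 1 := fun x => min_le_right _ _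
  have hlt : ∀ x, min (h x) 1 ≠ ∞ := fun x => ((hle x).trans_lt ENNReal.one_lt_top).ne
  have hhm : ∫⁻ x, ENNReal.ofReal ((min (h x) 1).toReal) ≤ ∫⁻ x, h x := by
    refine lintegral_mono fun x => ?_
    rw [ENNReal.ofReal_toReal (hlt x)]
    exact min_le_left _ _
  refine le_trans ?_ hhm
  rw [lintegral_eq_lintegral_meas_lt_of_le_one hf hf0 hf1,
    lintegral_eq_lintegral_meas_lt_of_le_one hg hg0 hg1,
    lintegral_eq_lintegral_meas_lt_of_le_one (by fun_prop) (fun _ => ENNReal.toReal_nonneg)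
      (fun x => by simpa using ENNReal.toReal_mono ENNReal.one_ne_top (hle x))]
  have hanti : ∀ k : ℝ → ℝ, Measurable fun s => volume {x | s < k x} := fun k =>
    Antitone.measurable fun s s' hs => measure_mono fun x hx => lt_of_le_of_lt hs hx
  rw [← lintegral_const_mul _ (hanti f), ← lintegral_const_mul _ (hanti g),
    ← lintegral_add_left ((hanti f).const_mul _)]
  -- Since s = s ^ t * s ^ (1 - t), the set t{f > s} + (1 - t){g > s} lies in {min h 1 > s};
  -- Brunn–Minkowski applies at each level.
  refine setLIntegral_mono (hanti _) fun s hs => ?_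
  refine (volume_weighted_add_le (measurableSet_lt measurable_const hf)
    (measurableSet_lt measurable_const hg) (hfs s hs.2) (hgs s hs.2) h0 h1).trans ?_
  apply measure_mono
  rintro _ ⟨_, ⟨x, hx, rfl⟩, _, ⟨y, hy, rfl⟩, rfl⟩
  simp only [Set.mem_ofPred_eq] at hx hy ⊢
  rw [← ENNReal.ofReal_lt_iff_lt_toReal hs.1.le (hlt _)]
  refine lt_min ?_ ?_
  · refine lt_of_lt_of_le ?_ (hfgh x y)
    rw [ENNReal.ofReal_rpow_of_nonneg (hf0 x) h0.le, ENNReal.ofReal_rpow_of_nonneg (hg0 y) h1'.le,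
      ← ENNReal.ofReal_mul (Real.rpow_nonneg (hf0 x) _)]
    have hsplit : s = s ^ t * s ^ (1 - t) := by
      rw [← Real.rpow_add hs.1]; simp
    have hx0 := hs.1.trans hx
    have hy0 := hs.1.trans hy
    refine (ENNReal.ofReal_lt_ofReal_iff (by positivity)).2 ?_
    rw [hsplit]
    have hs0 := hs.1
    exact mul_lt_mul'' (Real.rpow_lt_rpow hs.1.le hx h0) (Real.rpow_lt_rpow hs.1.le hy h1')
      (by positivity) (by positivity)
  · simpa using hs.2

theorem ENNReal.exists_real_eq_div_iSup {f : ℝ → ℝ≥0∞} (hf : Measurable f)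
    (ha0 : ⨆ x, f x ≠ 0) (hat : ⨆ x, f x ≠ ∞) :
    ∃ F : ℝ → ℝ, Measurable F ∧ (∀ x, 0 ≤ F x) ∧ (∀ x, F x ≤ 1) ∧ (∀ s < 1, ∃ x, s < F x) ∧
      ∀ x, ENNReal.ofReal (F x) = f x / ⨆ x, f x := by
  set a := ⨆ x, f x with ha
  have hle : ∀ x, f x / a ≤ 1 := fun x => ENNReal.div_le_of_le_mul (by simpa using le_iSup f x)
  have hlt : ∀ x, f x / a ≠ ∞ := fun x => ((hle x).trans_lt ENNReal.one_lt_top).ne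
  refine ⟨fun x => (f x / a).toReal, by fun_prop, fun x => ENNReal.toReal_nonneg,
    fun x => by simpa using ENNReal.toReal_mono ENNReal.one_ne_top (hle x), fun s hs => ?_,
    fun x => ENNReal.ofReal_toReal (hlt x)⟩
  rcases lt_or_ge s 0 with h | h
  · exact ⟨0, h.trans_le ENNReal.toReal_nonneg⟩
  · have : ENNReal.ofReal s * a < a := by
      conv_rhs => rw [← one_mul a]
      exact ENNReal.mul_lt_mul_left ha0 hat (by simpa using hs)
    obtain ⟨x, hx⟩ := lt_iSup_iff.1 (ha ▸ this)
    refine ⟨x, (ENNReal.ofReal_lt_iff_lt_toReal h (hlt x)).1 ?_⟩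
    rwa [ENNReal.lt_div_iff_mul_lt (Or.inl ha0) (Or.inl hat)]

theorem ENNReal.div_rpow_mul_div_rpow {a b : ℝ≥0∞} (ha0 : a ≠ 0) (hat : a ≠ ∞) {t : ℝ}
    (h0 : 0 ≤ t) (h1 : 0 ≤ 1 - t) (p q : ℝ≥0∞) :
    (p / a) ^ t * (q / b) ^ (1 - t) = p ^ t * q ^ (1 - t) / (a ^ t * b ^ (1 - t)) := by
  rw [ENNReal.div_rpow_of_nonneg _ _ h0, ENNReal.div_rpow_of_nonneg _ _ h1,
    div_eq_mul_inv, div_eq_mul_inv, div_eq_mul_inv,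
    ENNReal.mul_inv (Or.inl (by simp [ha0, hat])) (Or.inl (by simp [ha0, hat]))]
  ring

/-- By homogeneity `f` and `g` can be divided by their suprema a, b and `h` by a ^ t * b ^ (1 - t).
The additive form then applies, and weighted AM–GM turns it into the multiplicative one. -/
theorem lintegral_rpow_mul_rpow_le_of_iSup_ne_top {t : ℝ} (h0 : 0 < t) (h1 : t < 1)
    {f g h : ℝ → ℝ≥0∞} (hf : Measurable f) (hg : Measurable g) (hh : Measurable h)
    (hft : ⨆ x, f x ≠ ∞) (hgt : ⨆ x, g x ≠ ∞)
    (hfgh : ∀ x y, f x ^ t * g y ^ (1 - t) ≤ h (t • x + (1 - t) • y)) :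
    (∫⁻ x, f x) ^ t * (∫⁻ x, g x) ^ (1 - t) ≤ ∫⁻ x, h x := by
  have h1' := sub_pos.2 h1
  by_cases hf0 : ⨆ x, f x = 0
  · have : ∀ x, f x = 0 := by simpa using hf0
    simp [this, h0]
  by_cases hg0 : ⨆ x, g x = 0
  · have : ∀ x, g x = 0 := by simpa using hg0
    simp [this, h1]
  obtain ⟨F, hF, hF0, hF1, hFs, hFe⟩ := ENNReal.exists_real_eq_div_iSup hf hf0 hft
  obtain ⟨G, hG, hG0, hG1, hGs, hGe⟩ := ENNReal.exists_real_eq_div_iSup hg hg0 hgt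
  set a := ⨆ x, f x
  set b := ⨆ x, g x
  set c := a ^ t * b ^ (1 - t)
  have hat0 : a ^ t ≠ 0 := by simp [hf0, hft]
  have hbt0 : b ^ (1 - t) ≠ 0 := by simp [hg0, hgt]
  have hatt : a ^ t ≠ ∞ := by simp [hf0, hft]
  have hbtt : b ^ (1 - t) ≠ ∞ := by simp [hg0, hgt]
  have hc0 : c ≠ 0 := mul_ne_zero hat0 hbt0
  have hct : c ≠ ∞ := ENNReal.mul_ne_top hatt hbtt
  have hdiv := ENNReal.div_rpow_mul_div_rpow (b := b) hf0 hft h0.le h1'.le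
  have key := weighted_add_lintegral_le_of_sup_eq_one h0 h1 hF hG (hh.div_const c) hF0 hF1 hFs
    hG0 hG1 hGs (fun x y => by
      rw [hFe, hGe, hdiv]
      exact ENNReal.div_le_div_right (hfgh x y) _)
  simp only [hFe, hGe, div_eq_mul_inv] at key
  rw [lintegral_mul_const _ hf, lintegral_mul_const _ hg, lintegral_mul_const _ hh] at key
  have := (ENNReal.rpow_mul_rpow_le_weighted_add _ _ h0 h1).trans key
  rw [← div_eq_mul_inv, ← div_eq_mul_inv, ← div_eq_mul_inv, hdiv] at this
  exact (ENNReal.div_le_iff_le_mul (Or.inl hc0) (Or.inl hct)).1 this |>.trans_eq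
    (ENNReal.div_mul_cancel hc0 hct)

theorem lintegral_eq_iSup_lintegral_min_natCast {α : Type*} [MeasurableSpace α] (μ : Measure α)
    {f : α → ℝ≥0∞} (hf : Measurable f) :
    ∫⁻ x, f x ∂μ = ⨆ k : ℕ, ∫⁻ x, min (f x) k ∂μ := by
  have hm : Monotone fun (k : ℕ) x => min (f x) k := fun i j hij x =>
    min_le_min_left _ (by exact_mod_cast hij)
  rw [← lintegral_iSup (fun k => by fun_prop) hm]
  refine lintegral_congr fun x => ?_
  have := inf_iSup_eq (f x) (fun k : ℕ => (k : ℝ≥0∞))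
  rw [ENNReal.iSup_natCast, inf_top_eq] at this
  exact this

theorem prekopaLeindler_real {t : ℝ} (h0 : 0 < t) (h1 : t < 1) :
    PrekopaLeindler t (volume : Measure ℝ) := by
  intro f g h hf hg hh hfgh
  have h1' := sub_pos.2 h1
  rw [lintegral_eq_iSup_lintegral_min_natCast _ hf, lintegral_eq_iSup_lintegral_min_natCast _ hg]
  -- A positive power is an order isomorphism of [0, ∞], so it commutes with the supremum over
  -- truncations.
  have e1 := (ENNReal.orderIsoRpow t h0).map_iSup fun k : ℕ => ∫⁻ x, min (f x) k
  have e2 := (ENNReal.orderIsoRpow (1 - t) h1').map_iSup fun k : ℕ => ∫⁻ x, min (g x) k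
  simp only [ENNReal.orderIsoRpow_apply] at e1 e2
  rw [e1, e2]
  rw [ENNReal.iSup_mul]
  refine iSup_le fun i => ?_
  rw [ENNReal.mul_iSup]
  refine iSup_le fun j => ?_
  refine lintegral_rpow_mul_rpow_le_of_iSup_ne_top h0 h1 (by fun_prop) (by fun_prop) hh
    (ne_top_of_le_ne_top (ENNReal.natCast_ne_top i) (iSup_le fun x => min_le_right _ _))
    (ne_top_of_le_ne_top (ENNReal.natCast_ne_top j) (iSup_le fun x => min_le_right _ _))
    fun x y => le_trans ?_ (hfgh x y)
  gcongr
  · exact min_le_left _ _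
  · exact min_le_left _ _

/-! ### Passage to ℝⁿ -/

theorem PrekopaLeindler.prod {E F : Type*} [AddCommGroup E] [Module ℝ E] [MeasurableSpace E]
    [AddCommGroup F] [Module ℝ F] [MeasurableSpace F] {t : ℝ} {μ : Measure E} {ν : Measure F}
    [SFinite ν] (hμ : PrekopaLeindler t μ) (hν : PrekopaLeindler t ν) :
    PrekopaLeindler t (μ.prod ν) := by
  intro f g h hf hg hh hfgh
  rw [lintegral_prod _ hf.aemeasurable, lintegral_prod _ hg.aemeasurable,
    lintegral_prod _ hh.aemeasurable]
  -- `hν` on the fibres over x and y supplies the hypothesis of `hμ` for the fibre integrals.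
  exact hμ _ _ _ hf.lintegral_prod_right' hg.lintegral_prod_right' hh.lintegral_prod_right'
    fun x y => hν _ _ _ (by fun_prop) (by fun_prop) (by fun_prop)
      fun x' y' => hfgh (x, x') (y, y')

theorem PrekopaLeindler.of_measurePreserving {E F : Type*} [AddCommGroup E] [Module ℝ E]
    [MeasurableSpace E] [AddCommGroup F] [Module ℝ F] [MeasurableSpace F] {t : ℝ} {μ : Measure E}
    {ν : Measure F} (hμ : PrekopaLeindler t μ) {e : E → F} (he : MeasurePreserving e μ ν)
    (hlin : IsLinearMap ℝ e) : PrekopaLeindler t ν := by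
  intro f g h hf hg hh hfgh
  rw [← he.lintegral_comp hf, ← he.lintegral_comp hg, ← he.lintegral_comp hh]
  refine hμ _ _ _ (hf.comp he.measurable) (hg.comp he.measurable) (hh.comp he.measurable)
    fun x y => ?_
  rw [hlin.map_add, hlin.map_smul, hlin.map_smul]
  exact hfgh _ _

theorem prekopaLeindler_pi {t : ℝ} (h0 : 0 < t) (h1 : t < 1) (n : ℕ) :
    PrekopaLeindler t (volume : Measure (Fin n → ℝ)) := by
  induction n with
  | zero =>
    intro f g h _ _ _ hfgh
    rw [volume_pi, Measure.pi_of_empty _ 0]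
    simpa using hfgh 0 0
  | succ n ih =>
    refine ((prekopaLeindler_real h0 h1).prod ih).of_measurePreserving
      (volume_preserving_piFinSuccAbove (fun _ : Fin (n + 1) => ℝ) 0).symm ⟨?_, ?_⟩
    · intro x y
      ext i
      refine Fin.cases ?_ (fun j => ?_) i <;> simp [MeasurableEquiv.piFinSuccAbove]
    · intro c x
      ext i
      refine Fin.cases ?_ (fun j => ?_) i <;> simp [MeasurableEquiv.piFinSuccAbove]

/-- The Prékopa–Leindler inequality on `ℝⁿ`. -/
theorem prekopaLeindler_euclideanSpace {t : ℝ} (h0 : 0 < t) (h1 : t < 1) (n : ℕ) :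
    PrekopaLeindler t (volume : Measure (EuclideanSpace ℝ (Fin n))) :=
  (prekopaLeindler_pi h0 h1 n).of_measurePreserving (PiLp.volume_preserving_toLp (Fin n))
    ⟨fun _ _ => rfl, fun _ _ => rfl⟩

/-! ### Log-concave measures and log-concave densities -/

theorem PrekopaLeindler.isLogConcaveMeasure_withDensity {E : Type*} [AddCommGroup E] [Module ℝ E]
    [MeasurableSpace E] {μ : Measure E} (hμ : ∀ t : ℝ, 0 < t → t < 1 → PrekopaLeindler t μ)
    {ρ : E → ℝ≥0∞} (hρ : Measurable ρ)
    (hconc : ∀ t : ℝ, 0 < t → t < 1 → ∀ x y, ρ x ^ t * ρ y ^ (1 - t) ≤ ρ (t • x + (1 - t) • y)) :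
    IsLogConcaveMeasure (μ.withDensity ρ) := by
  intro A B hA hB t h0 h1
  set ν := μ.withDensity ρ with hν
  -- The Minkowski sum need not be measurable; its measurable hull has the same measure, so the
  -- inequality for indicators suffices.
  have hC := measurableSet_toMeasurable ν (t • A + (1 - t) • B)
  rw [← measure_toMeasurable (t • A + (1 - t) • B), hν, withDensity_apply _ hA,
    withDensity_apply _ hB, withDensity_apply _ hC, ← lintegral_indicator hA,
    ← lintegral_indicator hB, ← lintegral_indicator hC]
  refine hμ t h0 h1 _ _ _ (hρ.indicator hA) (hρ.indicator hB) (hρ.indicator hC) fun x y => ?_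
  by_cases hx : x ∈ A
  · by_cases hy : y ∈ B
    · rw [Set.indicator_of_mem hx, Set.indicator_of_mem hy, Set.indicator_of_mem]
      · exact hconc t h0 h1 x y
      · exact subset_toMeasurable _ _
          (Set.add_mem_add (Set.smul_mem_smul_set hx) (Set.smul_mem_smul_set hy))
    · simp [hy, h1]
  · simp [hx, h0]

theorem measurable_measure_closedBall {α : Type*} [PseudoMetricSpace α]
    [SecondCountableTopology α] [MeasurableSpace α] [BorelSpace α] (μ : Measure α) [SFinite μ]
    (r : ℝ) : Measurable fun x => μ (Metric.closedBall x r) := by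
  have hS : MeasurableSet {p : α × α | dist p.2 p.1 ≤ r} :=
    (isClosed_le (by fun_prop) continuous_const).measurableSet
  exact measurable_measure_prodMk_left (ν := μ) hS

/-- A log-concave measure that is absolutely continuous has a log-concave density, defined
everywhere: the lower limit of the mean values over small balls. -/
theorem IsLogConcaveMeasure.exists_logConcave_density {n : ℕ}
    {ρ : EuclideanSpace ℝ (Fin n) → ℝ≥0∞} (hρ : AEMeasurable ρ volume)
    [IsFiniteMeasure (volume.withDensity ρ)] (h : IsLogConcaveMeasure (volume.withDensity ρ)) :
    ∃ φ : EuclideanSpace ℝ (Fin n) → ℝ≥0∞, Measurable φ ∧ φ =ᵐ[volume] ρ ∧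
      ∀ t : ℝ, 0 < t → t < 1 → ∀ x y, φ x ^ t * φ y ^ (1 - t) ≤ φ (t • x + (1 - t) • y) := by
  set μ := volume.withDensity ρ with hμ
  let r : ℕ → ℝ := fun k => 1 / ((k : ℝ) + 1)
  have hr : ∀ k, 0 < r k := fun k => Nat.one_div_pos_of_nat
  let c : ℕ → ℝ≥0∞ := fun k => volume (Metric.closedBall (0 : EuclideanSpace ℝ (Fin n)) (r k))
  have hc0 : ∀ k, c k ≠ 0 := fun k => (Metric.measure_closedBall_pos _ _ (hr k)).ne'
  have hct : ∀ k, c k ≠ ∞ := fun k => measure_closedBall_lt_top.ne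
  let q : ℕ → EuclideanSpace ℝ (Fin n) → ℝ≥0∞ :=
    fun k x => μ (Metric.closedBall x (r k)) / c k
  have hq : ∀ k, Measurable (q k) := by
    intro k
    refine Measurable.div_const ?_ _
    exact measurable_measure_closedBall μ (r k)
  have hqc : ∀ k, ∀ t : ℝ, 0 < t → t < 1 → ∀ x y,
      q k x ^ t * q k y ^ (1 - t) ≤ q k (t • x + (1 - t) • y) := by
    intro k t h0 h1 x y
    have h1' := sub_pos.2 h1
    -- Balls of one radius combine to a ball of that radius, so all three averages share the
    -- normalization `c k`.
    have hball : t • Metric.closedBall x (r k) + (1 - t) • Metric.closedBall y (r k) =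
        Metric.closedBall (t • x + (1 - t) • y) (r k) := by
      rw [smul_closedBall _ _ (hr k).le, smul_closedBall _ _ (hr k).le,
        closedBall_add_closedBall (by have := hr k; positivity) (by have := hr k; positivity),
        Real.norm_of_nonneg h0.le, Real.norm_of_nonneg h1'.le]
      congr 1
      ring
    have hk := h _ _ (Metric.isClosed_closedBall (x := x) (ε := r k)).measurableSet
      (Metric.isClosed_closedBall (x := y) (ε := r k)).measurableSet t h0 h1
    rw [hball] at hk
    have hsplit : c k = c k ^ t * c k ^ (1 - t) := by
      rw [← ENNReal.rpow_add _ _ (hc0 k) (hct k)]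
      simp
    simp only [q]
    rw [ENNReal.div_rpow_mul_div_rpow (hc0 k) (hct k) h0.le h1'.le, ← hsplit]
    exact ENNReal.div_le_div_right hk _
  -- The lower limit exists everywhere and preserves the inequality; almost everywhere it is the
  -- limit, equal to `ρ` by Besicovitch differentiation.
  refine ⟨fun x => Filter.liminf (fun k => q k x) Filter.atTop, .liminf hq, ?_, ?_⟩
  · have hrn : μ.rnDeriv volume =ᵐ[volume] ρ := Measure.rnDeriv_withDensity₀ volume hρ
    filter_upwards [Besicovitch.ae_tendsto_rnDeriv μ volume, hrn] with x hx hxr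
    have hr0 : Filter.Tendsto r Filter.atTop (nhdsWithin 0 (Set.Ioi 0)) :=
      tendsto_nhdsWithin_iff.2 ⟨tendsto_one_div_add_atTop_nhds_zero_nat,
        Filter.Eventually.of_forall hr⟩
    rw [← hxr, ← (hx.comp hr0).liminf_eq]
    simp only [q, c, Function.comp_def, Measure.addHaar_closedBall_center]
  · intro t h0 h1 x y
    have h1' := sub_pos.2 h1
    simp only
    have e1 := (ENNReal.orderIsoRpow t h0).liminf_apply (f := Filter.atTop)
      (u := fun k => q k x)
    have e2 := (ENNReal.orderIsoRpow (1 - t) h1').liminf_apply (f := Filter.atTop)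
      (u := fun k => q k y)
    simp only [ENNReal.orderIsoRpow_apply] at e1 e2
    rw [e1, e2]
    exact (ENNReal.le_liminf_mul).trans
      (Filter.liminf_le_liminf (Filter.Eventually.of_forall fun k => hqc k t h0 h1 x y))

/-! ### Integrals of powers of a log-concave function -/

theorem lintegral_comp_inv_smul {n : ℕ} {f : EuclideanSpace ℝ (Fin n) → ℝ≥0∞} (hf : Measurable f)
    {c : ℝ} (hc : 0 < c) :
    ∫⁻ x, f (c⁻¹ • x) = ENNReal.ofReal (c ^ n) * ∫⁻ x, f x := by
  rw [← lintegral_map hf (measurable_const_smul _),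
    Measure.map_addHaar_smul volume (inv_ne_zero hc.ne'), lintegral_smul_measure]
  simp [abs_of_pos hc]

/-- For a log-concave function `φ`, the function `t ↦ tⁿ ∫ φ ^ t` is log-concave; here at the
midpoint of `1 - u` and `1 + u`. -/
theorem lintegral_rpow_mul_lintegral_rpow_le {n : ℕ} {φ : EuclideanSpace ℝ (Fin n) → ℝ≥0∞}
    (hφ : Measurable φ)
    (hconc : ∀ t : ℝ, 0 < t → t < 1 → ∀ x y, φ x ^ t * φ y ^ (1 - t) ≤ φ (t • x + (1 - t) • y))
    {u : ℝ} (hu : -1 < u) (hu' : u < 1) :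
    ENNReal.ofReal ((1 - u ^ 2) ^ n) * ((∫⁻ x, φ x ^ (1 - u)) * ∫⁻ x, φ x ^ (1 + u)) ≤
      (∫⁻ x, φ x) ^ 2 := by
  have ha : 0 < 1 - u := by linarith
  have hb : 0 < 1 + u := by linarith
  -- Log-concavity with weight (1 - u) / 2 at x / (1 - u) and y / (1 + u) lands at the midpoint (x +
  -- y) / 2. The dilations produce the factors (1 - u)ⁿ and (1 + u)ⁿ.
  have key := prekopaLeindler_euclideanSpace (t := 1 / 2) (by norm_num) (by norm_num) n
    (fun x => φ ((1 - u)⁻¹ • x) ^ (1 - u)) (fun x => φ ((1 + u)⁻¹ • x) ^ (1 + u)) φ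
    (by fun_prop) (by fun_prop) hφ fun x y => by
      have h := hconc ((1 - u) / 2) (by linarith) (by linarith) ((1 - u)⁻¹ • x) ((1 + u)⁻¹ • y)
      have e : (1 - (1 - u) / 2) = (1 + u) / 2 := by ring
      rw [e, smul_smul, smul_smul] at h
      have e1 : (1 - u) / 2 * (1 - u)⁻¹ = 1 / 2 := by field_simp
      have e2 : (1 + u) / 2 * (1 + u)⁻¹ = 1 - 1 / 2 := by field_simp; norm_num
      rw [e1, e2] at h
      rw [← ENNReal.rpow_mul, ← ENNReal.rpow_mul]
      convert! h using 3
      · ring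
      · ring
  rw [lintegral_comp_inv_smul (f := fun x => φ x ^ (1 - u)) (by fun_prop) ha,
    lintegral_comp_inv_smul (f := fun x => φ x ^ (1 + u)) (by fun_prop) hb,
    show (1 : ℝ) - 1 / 2 = 1 / 2 by norm_num,
    ← ENNReal.mul_rpow_of_nonneg _ _ (by norm_num : (0 : ℝ) ≤ 1 / 2)] at key
  have key2 := ENNReal.rpow_le_rpow key (by norm_num : (0 : ℝ) ≤ 2)
  rw [← ENNReal.rpow_mul, ENNReal.rpow_two] at key2
  norm_num at key2
  refine le_trans (le_of_eq ?_) key2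
  rw [show (1 - u ^ 2) = (1 - u) * (1 + u) by ring, mul_pow, ENNReal.ofReal_mul (by positivity)]
  ring

/-! ### From exponential moments to the variance -/

theorem deriv_deriv_nonpos_of_isLocalMax {f : ℝ → ℝ} {x : ℝ} (h : IsLocalMax f x)
    (hc : ContinuousAt f x) : deriv (deriv f) x ≤ 0 := by
  by_contra! hpos
  -- The point would also be a local minimum, making `f` locally constant with zero second
  -- derivative.
  have hmin := isLocalMin_of_deriv_deriv_pos hpos h.deriv_eq_zero hc
  have heq : f =ᶠ[nhds x] fun _ => f x := by
    filter_upwards [h, hmin] with y h1 h2 using le_antisymm h1 h2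
  have := heq.deriv.deriv_eq
  simp [this] at hpos

section Moments

variable {Ω : Type*} [MeasurableSpace Ω] {μ : Measure Ω} {X : Ω → ℝ}

theorem deriv_deriv_cgf_zero [IsProbabilityMeasure μ] (h : 0 ∈ interior (integrableExpSet X μ)) :
    deriv (deriv (cgf X μ)) 0 = Var[X; μ] := by
  have h2 : MemLp X 2 μ := by exact_mod_cast memLp_of_mem_interior_integrableExpSet h 2
  have := iteratedDeriv_two_cgf h
  rw [iteratedDeriv_succ, iteratedDeriv_one] at this
  rw [this, deriv_cgf_zero h, variance_eq_sub h2]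
  simp

theorem zero_mem_interior_integrableExpSet
    (hint : ∀ u : ℝ, -1 < u → u < 1 → Integrable (fun ω => Real.exp (u * X ω)) μ) :
    0 ∈ interior (integrableExpSet X μ) :=
  mem_interior.2 ⟨Set.Ioo (-1) 1, fun u hu => hint u hu.1 hu.2, isOpen_Ioo, by simp⟩

/-- The logarithm of the left side of `hle` is at most 0 and vanishes at u = 0. Its second
derivative at this maximum is 2 Var X - 2n. -/
theorem variance_le_of_mgf_mul_mgf_neg_le [IsProbabilityMeasure μ] (n : ℕ)
    (hint : ∀ u : ℝ, -1 < u → u < 1 → Integrable (fun ω => Real.exp (u * X ω)) μ)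
    (hle : ∀ u : ℝ, -1 < u → u < 1 → (1 - u ^ 2) ^ n * (mgf X μ u * mgf X μ (-u)) ≤ 1) :
    Var[X; μ] ≤ n := by
  have h0 := zero_mem_interior_integrableExpSet hint
  set L := cgf X μ with hL
  have hLa : AnalyticAt ℝ L 0 := analyticAt_cgf h0
  let g : ℝ → ℝ := fun u => L u + L (-u) + n * Real.log (1 - u ^ 2)
  have hIoo : ∀ᶠ u : ℝ in nhds 0, u ∈ Set.Ioo (-1 : ℝ) 1 :=
    Ioo_mem_nhds (by norm_num) (by norm_num)
  have hsq : ∀ {u : ℝ}, u ∈ Set.Ioo (-1 : ℝ) 1 → 0 < 1 - u ^ 2 := fun {u} hu => by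
    nlinarith [hu.1, hu.2]
  have hLd : ∀ᶠ u in nhds 0, HasDerivAt L (deriv L u) u :=
    hLa.eventually_analyticAt.mono fun u hu => hu.differentiableAt.hasDerivAt
  have hneg : Filter.Tendsto (fun u : ℝ => -u) (nhds 0) (nhds 0) := by
    simpa using (continuous_neg (G := ℝ)).tendsto 0
  have hgd : ∀ᶠ u in nhds 0,
      HasDerivAt g (deriv L u - deriv L (-u) + n * (-(2 * u) / (1 - u ^ 2))) u := by
    filter_upwards [hLd, hneg.eventually hLd, hIoo] with u h1 h2 hu
    have h3 : HasDerivAt (fun u : ℝ => 1 - u ^ 2) (-(2 * u)) u := by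
      simpa using (hasDerivAt_pow 2 u).const_sub 1
    have h4 := h2.scomp u (hasDerivAt_neg u)
    refine ((h1.add h4).add ((h3.log (hsq hu).ne').const_mul (n : ℝ))).congr_deriv ?_
    simp [sub_eq_add_neg]
  have hL2 : HasDerivAt (deriv L) Var[X; μ] 0 := by
    rw [← deriv_deriv_cgf_zero h0]
    exact hLa.deriv.differentiableAt.hasDerivAt
  have hgdd : deriv (deriv g) 0 = 2 * Var[X; μ] - 2 * n := by
    rw [Filter.EventuallyEq.deriv_eq (hgd.mono fun u hu => hu.deriv)]
    have h1 : HasDerivAt (fun u : ℝ => -(2 * u)) (-2) 0 := by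
      simpa using ((hasDerivAt_id (0 : ℝ)).const_mul 2).fun_neg
    have h2 : HasDerivAt (fun u : ℝ => 1 - u ^ 2) 0 0 := by
      simpa using (hasDerivAt_pow 2 (0 : ℝ)).const_sub 1
    have h3 : HasDerivAt (fun u : ℝ => deriv L (-u)) (-Var[X; μ]) 0 := by
      have := HasDerivAt.scomp (h := fun u : ℝ => -u) (h' := -1) (0 : ℝ)
        (by simpa using hL2) (hasDerivAt_neg 0)
      simpa [Function.comp_def] using this
    refine (((hL2.fun_sub h3).fun_add
      ((h1.fun_div h2 (by norm_num)).const_mul (n : ℝ))).congr_deriv ?_).deriv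
    norm_num
    ring
  have hmax : IsLocalMax g 0 := by
    filter_upwards [hIoo] with u hu
    have hu' : -u ∈ Set.Ioo (-1 : ℝ) 1 := ⟨by linarith [hu.2], by linarith [hu.1]⟩
    have p1 := mgf_pos (hint u hu.1 hu.2)
    have p2 := mgf_pos (hint (-u) hu'.1 hu'.2)
    have p3 := hsq hu
    have hlog : g u = Real.log ((1 - u ^ 2) ^ n * (mgf X μ u * mgf X μ (-u))) := by
      rw [Real.log_mul (by positivity) (by positivity), Real.log_mul p1.ne' p2.ne', Real.log_pow]
      simp only [g, hL, cgf]
      ring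
    have hg0 : g 0 = 0 := by simp [g, hL]
    rw [hg0, hlog]
    exact Real.log_nonpos (by positivity) (hle u hu.1 hu.2)
  have := deriv_deriv_nonpos_of_isLocalMax hmax hgd.self_of_nhds.continuousAt
  linarith

end Moments

/-! ### Exponential moments of the potential -/

theorem lintegral_ofReal_exp_mul_expNegMeasure {n : ℕ} {V : EuclideanSpace ℝ (Fin n) → EReal}
    (hV : AEMeasurable V volume) (hbot : ∀ x, V x ≠ ⊥) {u : ℝ} (hu : u < 1) :
    ∫⁻ x, ENNReal.ofReal (Real.exp (u * (V x).toReal)) ∂expNegMeasure V =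
      ∫⁻ x, EReal.exp (-V x) ^ (1 - u) := by
  have hd : AEMeasurable (fun x => EReal.exp (-V x)) volume := by fun_prop
  have hm : AEMeasurable (fun x => ENNReal.ofReal (Real.exp (u * (V x).toReal))) volume := by
    have := measurable_ereal_toReal.comp_aemeasurable hV
    exact (Real.measurable_exp.comp_aemeasurable (this.const_mul u)).ennreal_ofReal
  rw [expNegMeasure, lintegral_withDensity_eq_lintegral_mul₀ hd hm]
  refine lintegral_congr fun x => ?_
  have hx := hbot x
  simp only [Pi.mul_apply]
  generalize V x = v at hx ⊢
  induction v with
  | bot => exact absurd rfl hx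
  -- Here `toReal` is 0, so the left integrand is 0 * 1; the right one is 0 ^ (1 - u), which
  -- vanishes because u < 1.
  | top => simp [hu]
  | coe v =>
    rw [← EReal.coe_neg, EReal.exp_coe, EReal.toReal_coe, ← ENNReal.ofReal_mul (by positivity),
      ENNReal.ofReal_rpow_of_pos (by positivity), ← Real.exp_add, ← Real.exp_mul]
    congr 2
    ring

theorem mgf_eq_toReal_lintegral {Ω : Type*} [MeasurableSpace Ω] {μ : Measure Ω} {X : Ω → ℝ}
    (hX : AEMeasurable X μ) (u : ℝ) :
    mgf X μ u = (∫⁻ ω, ENNReal.ofReal (Real.exp (u * X ω)) ∂μ).toReal :=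
  integral_eq_lintegral_of_nonneg_ae (ae_of_all _ fun _ => (Real.exp_pos _).le)
    (Real.measurable_exp.comp_aemeasurable (hX.const_mul u)).aestronglyMeasurable

section Varentropy

variable {n : ℕ} {V : EuclideanSpace ℝ (Fin n) → EReal}

theorem aemeasurable_toReal_expNegMeasure (hV : AEMeasurable V volume) :
    AEMeasurable (fun x => (V x).toReal) (expNegMeasure V) :=
  (measurable_ereal_toReal.comp_aemeasurable hV).mono_ac (withDensity_absolutelyContinuous _ _)

theorem IsLogConcaveMeasure.lintegral_exp_mul_lintegral_exp_neg_le
    (hV : AEMeasurable V volume) (hbot : ∀ x, V x ≠ ⊥) [IsProbabilityMeasure (expNegMeasure V)]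
    (hlc : IsLogConcaveMeasure (expNegMeasure V)) {u : ℝ} (hu : -1 < u) (hu' : u < 1) :
    ENNReal.ofReal ((1 - u ^ 2) ^ n) *
      ((∫⁻ x, ENNReal.ofReal (Real.exp (u * (V x).toReal)) ∂expNegMeasure V) *
        ∫⁻ x, ENNReal.ofReal (Real.exp (-u * (V x).toReal)) ∂expNegMeasure V) ≤ 1 := by
  have hd : AEMeasurable (fun x => EReal.exp (-V x)) volume := by fun_prop
  have : IsFiniteMeasure (volume.withDensity fun x => EReal.exp (-V x)) :=
    inferInstanceAs (IsFiniteMeasure (expNegMeasure V))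
  -- `EReal.exp (-V x)` need not be log-concave pointwise; the version `φ` is, and has the same
  -- integrals of powers.
  obtain ⟨φ, hφ, hφV, hconc⟩ := IsLogConcaveMeasure.exists_logConcave_density hd hlc
  have hpow : ∀ p : ℝ, ∫⁻ x, φ x ^ p = ∫⁻ x, EReal.exp (-V x) ^ p := fun p =>
    lintegral_congr_ae (hφV.mono fun x hx => by simp only [hx])
  have hone : ∫⁻ x, φ x = 1 := by
    rw [lintegral_congr_ae hφV, ← setLIntegral_univ, ← withDensity_apply _ MeasurableSet.univ]
    exact measure_univ (μ := expNegMeasure V)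
  have h := lintegral_rpow_mul_lintegral_rpow_le hφ hconc hu hu'
  rw [hone, one_pow, hpow, hpow] at h
  rwa [lintegral_ofReal_exp_mul_expNegMeasure hV hbot hu',
    lintegral_ofReal_exp_mul_expNegMeasure hV hbot (by linarith : -u < 1), sub_neg_eq_add]

/-- The moments at u and -u have a bounded product and neither is zero, so neither is infinite. -/
theorem IsLogConcaveMeasure.integrable_exp_mul
    (hV : AEMeasurable V volume) (hbot : ∀ x, V x ≠ ⊥) [IsProbabilityMeasure (expNegMeasure V)]
    (hlc : IsLogConcaveMeasure (expNegMeasure V)) {u : ℝ} (hu : -1 < u) (hu' : u < 1) :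
    Integrable (fun x => Real.exp (u * (V x).toReal)) (expNegMeasure V) := by
  have hm : ∀ w : ℝ, AEMeasurable (fun x => Real.exp (w * (V x).toReal)) (expNegMeasure V) :=
    fun w => Real.measurable_exp.comp_aemeasurable
      ((aemeasurable_toReal_expNegMeasure hV).const_mul w)
  rw [← lintegral_ofReal_ne_top_iff_integrable (hm u).aestronglyMeasurable
    (ae_of_all _ fun _ => (Real.exp_pos _).le)]
  intro htop
  have h := hlc.lintegral_exp_mul_lintegral_exp_neg_le hV hbot hu hu'
  have hpos : ∫⁻ x, ENNReal.ofReal (Real.exp (-u * (V x).toReal)) ∂expNegMeasure V ≠ 0 := by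
    rw [Ne, lintegral_eq_zero_iff' (hm (-u)).ennreal_ofReal]
    intro h0
    obtain ⟨x, hx⟩ := h0.exists
    exact absurd (ENNReal.ofReal_eq_zero.1 hx) (not_le.2 (Real.exp_pos _))
  have hsq : 0 < 1 - u ^ 2 := by nlinarith
  rw [htop, ENNReal.top_mul hpos, ENNReal.mul_top (by simpa using pow_pos hsq n)] at h
  simp at h

theorem IsLogConcaveMeasure.memLp_two_toReal
    (hV : AEMeasurable V volume) (hbot : ∀ x, V x ≠ ⊥) [IsProbabilityMeasure (expNegMeasure V)]
    (hlc : IsLogConcaveMeasure (expNegMeasure V)) :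
    MemLp (fun x => (V x).toReal) 2 (expNegMeasure V) := by
  exact_mod_cast memLp_of_mem_interior_integrableExpSet (zero_mem_interior_integrableExpSet
    fun u hu hu' => hlc.integrable_exp_mul hV hbot hu hu') 2

/-- The varentropy of a log-concave probability measure on `ℝⁿ` is at most `n`. -/
theorem IsLogConcaveMeasure.variance_toReal_le
    (hV : AEMeasurable V volume) (hbot : ∀ x, V x ≠ ⊥) [IsProbabilityMeasure (expNegMeasure V)]
    (hlc : IsLogConcaveMeasure (expNegMeasure V)) :
    Var[fun x => (V x).toReal; expNegMeasure V] ≤ n := by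
  have hX := aemeasurable_toReal_expNegMeasure hV
  refine variance_le_of_mgf_mul_mgf_neg_le n
    (fun u hu hu' => hlc.integrable_exp_mul hV hbot hu hu') fun u hu hu' => ?_
  have hsq : 0 < 1 - u ^ 2 := by nlinarith
  have h := ENNReal.toReal_mono ENNReal.one_ne_top
    (hlc.lintegral_exp_mul_lintegral_exp_neg_le hV hbot hu hu')
  rw [ENNReal.toReal_mul, ENNReal.toReal_mul, ENNReal.toReal_ofReal (by positivity),
    ENNReal.toReal_one] at h
  rwa [mgf_eq_toReal_lintegral hX, mgf_eq_toReal_lintegral hX]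

theorem integral_expNegMeasure (hV : AEMeasurable V volume) (hbot : ∀ x, V x ≠ ⊥)
    (g : EuclideanSpace ℝ (Fin n) → ℝ) :
    ∫ x, g x ∂expNegMeasure V = ∫ x, g x * (EReal.exp (-V x)).toReal := by
  rw [expNegMeasure, integral_withDensity_eq_integral_toReal_smul₀ (by fun_prop)
    (ae_of_all _ fun x => by
      rw [EReal.exp_lt_top_iff, lt_top_iff_ne_top, Ne, EReal.neg_eq_top_iff]
      exact hbot x)]
  simp only [smul_eq_mul, mul_comm]

end Varentropy

/-! ### The product exponential distribution -/

theorem integral_exp_neg_mul_abs {c : ℝ} (hc : 0 < c) : ∫ x : ℝ, Real.exp (-c * |x|) = 2 / c := by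
  rw [integral_comp_abs (f := fun x => Real.exp (-c * x)), integral_exp_mul_Ioi (by linarith)]
  simp
  ring

theorem integral_exp_neg_mul_sum_abs {c : ℝ} (hc : 0 < c) (n : ℕ) :
    ∫ x : EuclideanSpace ℝ (Fin n), Real.exp (-c * ∑ i, |x i|) = (2 / c) ^ n := by
  rw [← (PiLp.volume_preserving_toLp (Fin n)).integral_comp
    (MeasurableEquiv.toLp 2 (Fin n → ℝ)).measurableEmbedding]
  simp only [Finset.mul_sum, Real.exp_sum]
  rw [integral_fintype_prod_volume_eq_pow (fun x : ℝ => Real.exp (-c * |x|)),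
    integral_exp_neg_mul_abs hc, Fintype.card_fin]

theorem integrable_exp_neg_mul_sum_abs {c : ℝ} (hc : 0 < c) (n : ℕ) :
    Integrable fun x : EuclideanSpace ℝ (Fin n) => Real.exp (-c * ∑ i, |x i|) := by
  -- A non-integrable function has Bochner integral 0 by convention, against the positive value (2 /
  -- c)ⁿ.
  by_contra hi
  have h := integral_exp_neg_mul_sum_abs hc n
  rw [integral_undef hi] at h
  exact (by positivity : (2 / c) ^ n ≠ 0) h.symm

theorem expNegMeasure_productExponentialPotential (n : ℕ) :
    productExponential n = expNegMeasure (productExponentialPotential n) := by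
  unfold productExponential expNegMeasure
  congr 1
  ext x
  rw [productExponentialPotential, ← EReal.coe_neg, EReal.exp_coe, neg_add, Real.exp_add,
    Real.exp_neg (_ * _), Real.exp_nat_mul, Real.exp_log two_pos, div_eq_mul_inv]

theorem isProbabilityMeasure_productExponential (n : ℕ) :
    IsProbabilityMeasure (productExponential n) := by
  refine ⟨?_⟩
  have hi := integrable_exp_neg_mul_sum_abs one_pos n
  have h := integral_exp_neg_mul_sum_abs one_pos n
  simp only [neg_mul, one_mul] at hi h
  rw [productExponential, withDensity_apply _ MeasurableSet.univ, setLIntegral_univ,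
    ← ofReal_integral_eq_lintegral_ofReal (hi.div_const _) (ae_of_all _ fun x => by positivity),
    integral_div, h]
  simp

theorem isLogConcaveMeasure_productExponential (n : ℕ) :
    IsLogConcaveMeasure (productExponential n) := by
  refine PrekopaLeindler.isLogConcaveMeasure_withDensity
    (fun t h0 h1 => prekopaLeindler_euclideanSpace h0 h1 n) (by fun_prop) fun t h0 h1 x y => ?_
  have h1' := sub_pos.2 h1
  rw [ENNReal.ofReal_rpow_of_nonneg (by positivity) h0.le,
    ENNReal.ofReal_rpow_of_nonneg (by positivity) h1'.le, ← ENNReal.ofReal_mul (by positivity)]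
  refine ENNReal.ofReal_le_ofReal ?_
  rw [Real.div_rpow (by positivity) (by positivity), Real.div_rpow (by positivity) (by positivity),
    div_mul_div_comm, ← Real.rpow_add (by positivity), ← Real.exp_mul, ← Real.exp_mul,
    ← Real.exp_add, add_sub_cancel, Real.rpow_one]
  gcongr
  simp only [PiLp.add_apply, PiLp.smul_apply, smul_eq_mul]
  -- Log-concavity of the density is convexity of the ℓ¹ norm.
  have : ∑ i, |t * x i + (1 - t) * y i| ≤ ∑ i, (t * |x i| + (1 - t) * |y i|) := by
    refine Finset.sum_le_sum fun i _ => (abs_add_le _ _).trans_eq ?_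
    rw [abs_mul, abs_mul, abs_of_pos h0, abs_of_pos h1']
  rw [Finset.sum_add_distrib, ← Finset.mul_sum, ← Finset.mul_sum] at this
  linarith

theorem exp_mul_productExponentialPotential (n : ℕ) (u : ℝ) (x : EuclideanSpace ℝ (Fin n)) :
    Real.exp (u * (productExponentialPotential n x).toReal) *
      (EReal.exp (-productExponentialPotential n x)).toReal =
    Real.exp (-(1 - u) * ∑ i, |x i|) * Real.exp (-(1 - u) * (n * Real.log 2)) := by
  rw [productExponentialPotential, ← EReal.coe_neg, EReal.exp_coe, EReal.toReal_coe,
    ENNReal.toReal_ofReal (Real.exp_pos _).le, ← Real.exp_add, ← Real.exp_add]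
  congr 1
  ring

theorem measurable_productExponentialPotential (n : ℕ) :
    Measurable (productExponentialPotential n) := by
  unfold productExponentialPotential
  exact measurable_coe_real_ereal.comp (by fun_prop)

theorem mgf_productExponentialPotential (n : ℕ) {u : ℝ} (hu : u < 1) :
    mgf (fun x => (productExponentialPotential n x).toReal) (productExponential n) u =
      Real.exp (u * (n * Real.log 2)) * ((1 - u)⁻¹) ^ n := by
  rw [mgf, expNegMeasure_productExponentialPotential,
    integral_expNegMeasure (measurable_productExponentialPotential n).aemeasurable
      fun x => EReal.coe_ne_bot _]
  simp only [exp_mul_productExponentialPotential]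
  rw [integral_mul_const, integral_exp_neg_mul_sum_abs (sub_pos.2 hu), div_eq_mul_inv, mul_pow,
    mul_right_comm]
  congr 1
  rw [neg_sub, sub_mul, one_mul, Real.exp_sub, Real.exp_nat_mul, Real.exp_log two_pos]
  field_simp

/-- The cumulant generating function near 0 is n u log 2 - n log(1 - u), with second derivative n at
0. -/
theorem variance_productExponentialPotential (n : ℕ) :
    Var[fun x => (productExponentialPotential n x).toReal; productExponential n] = n := by
  have := isProbabilityMeasure_productExponential n
  have hmgf := fun (u : ℝ) (hu : u < 1) => mgf_productExponentialPotential n hu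
  set X := fun x => (productExponentialPotential n x).toReal
  have hint : ∀ u : ℝ, -1 < u → u < 1 →
      Integrable (fun x => Real.exp (u * X x)) (productExponential n) := by
    intro u _ hu'
    by_contra hi
    have h := hmgf u hu'
    have := sub_pos.2 hu'
    rw [mgf, integral_undef hi] at h
    exact (by positivity : Real.exp (u * (n * Real.log 2)) * ((1 - u)⁻¹) ^ n ≠ 0) h.symm
  rw [← deriv_deriv_cgf_zero (zero_mem_interior_integrableExpSet hint)]
  have hlt : ∀ᶠ u : ℝ in nhds 0, u < 1 := Iio_mem_nhds one_pos
  have hcgf : cgf X (productExponential n) =ᶠ[nhds 0]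
      fun u => n * Real.log 2 * u - n * Real.log (1 - u) := by
    filter_upwards [hlt] with u hu
    have h1 := sub_pos.2 hu
    rw [cgf, hmgf u hu, Real.log_mul (by positivity) (by positivity), Real.log_exp, Real.log_pow,
      Real.log_inv]
    ring
  have hd : deriv (cgf X (productExponential n)) =ᶠ[nhds 0]
      fun u => n * Real.log 2 + n * (1 - u)⁻¹ := by
    refine hcgf.deriv.trans ?_
    filter_upwards [hlt] with u hu
    have h1 : HasDerivAt (fun u : ℝ => 1 - u) (-1) u := (hasDerivAt_id u).const_sub 1
    refine ((((hasDerivAt_id u).const_mul (n * Real.log 2)).fun_sub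
      ((h1.log (sub_pos.2 hu).ne').const_mul (n : ℝ))).congr_deriv ?_).deriv
    simp [div_eq_mul_inv]
  rw [hd.deriv_eq]
  have h1 : HasDerivAt (fun u : ℝ => 1 - u) (-1) 0 := (hasDerivAt_id 0).const_sub 1
  refine ((((h1.fun_inv (by norm_num)).const_mul (n : ℝ)).const_add
    (n * Real.log 2)).congr_deriv ?_).deriv
  norm_num

theorem corollary6 (n : ℕ) :
    (∀ (μ : Measure (EuclideanSpace ℝ (Fin n))) (V : EuclideanSpace ℝ (Fin n) → EReal),
      AEMeasurable V volume → (∀ x, V x ≠ ⊥) → μ = expNegMeasure V →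
      IsProbabilityMeasure μ → IsLogConcaveMeasure μ →
        MemLp (fun x => (V x).toReal) 2 μ ∧
        Var[fun x => (V x).toReal; μ] =
          (∫ x, (V x).toReal ^ 2 * (EReal.exp (-V x)).toReal) -
            (∫ x, (V x).toReal * (EReal.exp (-V x)).toReal) ^ 2 ∧
        Var[fun x => (V x).toReal; μ] ≤ n) ∧
    (IsProbabilityMeasure (productExponential n) ∧
      IsLogConcaveMeasure (productExponential n) ∧
      productExponential n = expNegMeasure (productExponentialPotential n) ∧
      Var[fun x => (productExponentialPotential n x).toReal; productExponential n] = n) := by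
  refine ⟨?_, isProbabilityMeasure_productExponential n, isLogConcaveMeasure_productExponential n,
    expNegMeasure_productExponentialPotential n, variance_productExponentialPotential n⟩
  rintro μ V hV hbot rfl hprob hlc
  have h2 := hlc.memLp_two_toReal hV hbot
  refine ⟨h2, ?_, hlc.variance_toReal_le hV hbot⟩
  rw [variance_eq_sub h2, integral_expNegMeasure hV hbot, integral_expNegMeasure hV hbot]
  simp only [Pi.pow_apply]
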